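/- For $n\in\mathbb N$ put $\mathbb Z_n=\{0,1,\dots,n-1\}$ and let $(a)^{\overline{j}}=a(a+1)\cdots(a+j-1)$, $(a)^{\overline{0}}=1$, be the rising factorial. For real $a_1,a_2,b_1,b_2$ let $$ {}_3\mathcal F_2\left(\begin{matrix}-n,\ a_1,\ a_2\\ b_1,\ b_2\end{matrix};x\right)=\sum_{j=0}^n (-n)^{\overline{j}}\,(a_1)^{\overline{j}}(a_2)^{\overline{j}}\,(b_1+j)^{\overline{n-j}}(b_2+j)^{\overline{n-j}}\,\frac{x^j}{j!} $$ be the hypergeometric polynomial in standard normalization (it equals $(b_1)^{\overline{n}}(b_2)^{\overline{n}}$ times the terminating series ${}_3F_2(-n,a_1,a_2;b_1,b_2;x)$ whenever this factor is non-zero). For $K\subset\mathbb C$ let $\mathbb P_n(K)$ be the set of polynomials of degree at most $n$ all of whose complex zeros lie in $K$ (the zero polynomial is excluded if $K\ne\mathbb C$). Let $n\ge 4$, $k\in\mathbb Z_n$, $t\in\mathbb Z_n\cup\mathbb R_{>n-2}$, let $a_1,a_2,b_1,b_2\in\mathbb R$ with $-a_1,-a_2\notin\mathbb Z_n$, and let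 $b_2>0$. If $a_2<-n+1$, then ${}_3\mathcal F_2\left(\begin{matrix}-n,\ a_1,\ a_2\\ b_1,\ b_2\end{matrix};x\right)\in\mathbb P_n(\mathbb R_{<0})$ whenever one of the following holds: (i) $b_1=-n-k+\tfrac12$, and either $a_1=-a_2-2n<-n+1$ or $a_1=-a_2-2n+1<-n+1$; (ii) $b_1=a_1-k+\tfrac12$ and $a_1=(a_2-n-t)/2$; (iii) $b_1=(a_1-n)/2-k$, $a_1=2a_2+n+1-2t$, and $a_1<-n+1$; (iv) $b_1=(a_1-n+1)/2-k$, $a_1=2a_2+n-2t$, and moreover $a_1<-n+1$ or $k=0$. Moreover (without the assumption $a_2<-n+1$), ${}_3\mathcal F_2\left(\begin{matrix}-n,\ a_1,\ a_2\\ b_1,\ b_2\end{matrix};x\right)\in\mathbb P_n(\mathbb R)$ whenever one of the following holds: (v) $b_1=a_2+\tfrac12$, $a_1=2a_2+n+1$, and $a_2\in(-n,-n+1)$; (vi) $b_1=a_2+\tfrac12$, $a_1=2a_2+n$, and $a_2\in(-n+1,-n+2)$; (vii) $b_1=a_2-k+\tfrac12$, $a_1=2a_2+n+1$, and $a_2\in(-n,-n+\tfrac12)$;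 (viii) $b_1=-n-k+\tfrac12$, $a_1+a_2+2n\in\{0,1\}$, and $a_2\in(-n+1,-n+2)$. -/

import Mathlib

open Polynomial

/-- The set `ℤ_n = {0, 1, …, n - 1}`, as a set of real numbers. -/
def zSet (n : ℕ) : Set ℝ := {x | ∃ m : ℕ, m < n ∧ x = m}

/-- The rising factorial `a (a + 1) ⋯ (a + j - 1)`. -/
noncomputable def risingFactorial (a : ℝ) (j : ℕ) : ℝ := (ascPochhammer ℝ j).eval a

/-- The generalized hypergeometric polynomial in standard normalization, with upper parameters
`-n` and the entries of `a`, and lower parameters the entries of `b`: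
`∑_{j=0}^{n} (-n)^{(j)} · ∏_s (a_s)^{(j)} · ∏_s (b_s + j)^{(n-j)} · x ^ j / j!`.
As `(b_s)^{(n)} = (b_s)^{(j)} (b_s + j)^{(n-j)}`, it is `∏_s (b_s)^{(n)}` times the terminating
hypergeometric series whenever no `(b_s)^{(n)}` vanishes; it makes sense for all parameters. -/
noncomputable def hypergeometricPoly (n : ℕ) (a b : List ℝ) : ℝ[X] :=
  ∑ j ∈ Finset.range (n + 1),
    C (risingFactorial (-(n : ℝ)) j
        * (a.map fun α => risingFactorial α j).prod
        * (b.map fun β => risingFactorial (β + j) (n - j)).prod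
        / (j.factorial : ℝ)) * X ^ j

/-- The real polynomials of degree at most `n` all of whose complex zeros lie in `K`
(the zero polynomial, which vanishes everywhere, belongs to it only for `K = ℂ`). -/
def polysWithZerosIn (n : ℕ) (K : Set ℂ) : Set ℝ[X] :=
  {p | p.natDegree ≤ n ∧ ∀ z : ℂ, aeval z p = 0 → z ∈ K}

/-- The real line inside `ℂ`. -/
def realLine : Set ℂ := Set.range (fun x : ℝ => (x : ℂ))

/-- The negative half-line inside `ℂ`. -/
def negativeLine : Set ℂ := (fun x : ℝ => (x : ℂ)) '' Set.Iio 0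

/-! Reversing the order of the coefficients turns the parameters into `N = 1 - n - b₁`, `c = 1 - n -
a₁`, `d = 1 - n - a₂`. Up to a non-zero factor the polynomial is then `∑ binom(n, j) x ^ j v_(n-j) /
(b₂)_j` with `v_i = (N)_i / ((c)_i (d)_i)`. Since `b₂ > 0`, dividing by `(b₂)_j` preserves
real-rootedness, so it suffices that the Jensen polynomial of `v` is real-rooted. If moreover all
`v_i` are positive, the zeros are negative.

The source of such `v` is a product of two Bessel-type functions `₀F₁(p) ₀F₁(q)`. Its exponential
coefficients are `(p + q - 1 + i)_i / ((p)_i (q)_i)`. Their Jensen polynomials are real-rooted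
because a real-rooted polynomial in `d/dx` preserves real-rootedness (Hermite–Poulain), and the
binomial convolution is a limit of such operators (`RealRooted.jensen_binomConv`). With `p + q - 1 =
2 * e`, the duplication formula converts the numerator into `(e)_i (e + 1/2)_i / (2e)_i`. Special
choices of `p`, `q` cancel one more factor and leave a quotient of the shape `v`
(`realRooted_jensen_duplication`).

Two operations widen these families. Multiplying by `(N + i)_k` raises `N` by `k`. The Jacobi
multiplier `(d + t)_i / (d)_i` replaces `d + t` by `d`. It comes from iterated Euler operators for
natural `t`, and otherwise from Szegő's composition theorem, proved here through Laguerre and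
Grace–Walsh–Szegő (`RealRooted.jensen_mul_jacobi`). -/

/-- A complex polynomial is real-rooted if it does not vanish off the real line. -/
def RealRooted (p : ℂ[X]) : Prop := ∀ z : ℂ, z.im ≠ 0 → p.eval z ≠ 0

/-! ### Real-rootedness under first-order differential operators -/

theorem RealRooted.ne_zero {p : ℂ[X]} (hp : RealRooted p) : p ≠ 0 := by
  rintro rfl
  exact hp Complex.I (by simp) (by simp)

theorem RealRooted.im_root {p : ℂ[X]} (hp : RealRooted p) {r : ℂ} (hr : r ∈ p.roots) :
    r.im = 0 := by
  by_contra h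
  exact hp r h (isRoot_of_mem_roots hr)

theorem eval_derivative_eq_mul_sum_roots (p : ℂ[X]) {z : ℂ} (hz : p.eval z ≠ 0) :
    p.derivative.eval z = p.eval z * (p.roots.map fun r => 1 / (z - r)).sum :=
  (IsAlgClosed.splits p).eval_derivative_eq_eval_mul_sum hz

/-- For real roots, `∑ 1 / (z - r) = -(im z) * A` with `A ≥ 0` the sum of `1 / |z - r| ^ 2`. -/
theorem im_sum_inv_sub (s : Multiset ℂ) (hs : ∀ r ∈ s, r.im = 0) (z : ℂ) :
    (s.map fun r => 1 / (z - r)).sum.im =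
      -(z.im * (s.map fun r => (Complex.normSq (z - r))⁻¹).sum) := by
  induction s using Multiset.induction_on with
  | empty => simp
  | cons a s ih =>
    have ha := hs a (Multiset.mem_cons_self a s)
    simp only [Multiset.map_cons, Multiset.sum_cons, Complex.add_im]
    rw [ih fun r hr => hs r (Multiset.mem_cons_of_mem hr)]
    simp [Complex.inv_im, ha]
    ring

/-- Each term is `1 + r / (z - r)`, so with real roots of one sign every term contributes an
imaginary part of the same sign. -/
theorem im_mul_sum_inv_sub (s : Multiset ℂ) (hs : ∀ r ∈ s, r.im = 0) (z : ℂ) :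
    (z * (s.map fun r => 1 / (z - r)).sum).im =
      z.im * (s.map fun r => -(r.re * (Complex.normSq (z - r))⁻¹)).sum := by
  induction s using Multiset.induction_on with
  | empty => simp
  | cons a s ih =>
    have ha := hs a (Multiset.mem_cons_self a s)
    simp only [Multiset.map_cons, Multiset.sum_cons, Complex.add_im, mul_add]
    rw [ih fun r hr => hs r (Multiset.mem_cons_of_mem hr)]
    simp [Complex.inv_im, Complex.inv_re, ha]
    ring

theorem sum_inv_normSq_nonneg (s : Multiset ℂ) (z : ℂ) :
    0 ≤ (s.map fun r => (Complex.normSq (z - r))⁻¹).sum := by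
  refine Multiset.sum_nonneg fun x hx => ?_
  obtain ⟨r, -, rfl⟩ := Multiset.mem_map.1 hx
  exact inv_nonneg.2 (Complex.normSq_nonneg _)

theorem sum_pos_of_mem {s : Multiset ℂ} {f : ℂ → ℝ} (hf : ∀ r ∈ s, 0 < f r) (h0 : s ≠ 0) :
    0 < (s.map f).sum := by
  induction s using Multiset.induction_on with
  | empty => exact absurd rfl h0
  | cons a s ih =>
    rw [Multiset.map_cons, Multiset.sum_cons]
    have ha := hf a (Multiset.mem_cons_self a s)
    by_cases hs : s = 0
    · simpa [hs] using ha
    · exact add_pos ha (ih (fun r hr => hf r (Multiset.mem_cons_of_mem hr)) hs)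

theorem normSq_sub_pos {z r : ℂ} (hz : z.im ≠ 0) (hr : r.im = 0) :
    0 < Complex.normSq (z - r) := by
  rw [Complex.normSq_pos]
  intro h
  have := congrArg Complex.im h
  simp [hr] at this
  exact hz this

/-- `p + w p'` is real-rooted together with `p`. -/
theorem RealRooted.add_smul_derivative {p : ℂ[X]} (hp : RealRooted p) (w : ℝ) :
    RealRooted (p + C (w : ℂ) * derivative p) := by
  intro z hz h
  have h0 := hp z hz
  rw [eval_add, eval_mul, eval_C, eval_derivative_eq_mul_sum_roots p h0] at h
  have h1 : 1 + (w : ℂ) * (p.roots.map fun r => 1 / (z - r)).sum = 0 := by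
    apply mul_left_cancel₀ h0
    linear_combination h
  have him := congrArg Complex.im h1
  have hre := congrArg Complex.re h1
  simp only [Complex.add_im, Complex.one_im, Complex.re_ofReal_mul, Complex.im_ofReal_mul,
    Complex.add_re, Complex.one_re, Complex.zero_im, Complex.zero_re, zero_add] at him hre
  -- The logarithmic derivative of a real-rooted polynomial has non-zero imaginary part off the real
  -- line unless there are no roots. With `w = 0` or no roots, the real part of the equation reads
  -- `1 = 0`.
  rcases mul_eq_zero.1 him with hw | hw
  · simp [hw] at hre
  · rw [im_sum_inv_sub _ (fun r hr => hp.im_root hr)] at hw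
    by_cases hs : p.roots = 0
    · simp [hs] at hre
    · have := sum_pos_of_mem (f := fun r => (Complex.normSq (z - r))⁻¹)
        (fun r hr => inv_pos.2 (normSq_sub_pos hz (hp.im_root hr))) hs
      rw [neg_eq_zero, mul_eq_zero] at hw
      rcases hw with hw | hw
      · exact hz hw
      · exact this.ne' hw

/-- `x p' + s p` is real-rooted together with `p` when `s > 0`. -/
theorem RealRooted.X_mul_derivative_add {p : ℂ[X]} (hp : RealRooted p) {s : ℝ} (hs : 0 < s) :
    RealRooted (X * derivative p + C (s : ℂ) * p) := by
  intro z hz h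
  have h0 := hp z hz
  rw [eval_add, eval_mul, eval_mul, eval_C, eval_X, eval_derivative_eq_mul_sum_roots p h0] at h
  set S := (p.roots.map fun r => 1 / (z - r)).sum with hS
  have h1 : z * S + s = 0 := by
    apply mul_left_cancel₀ h0
    linear_combination h
  have hz0 : z ≠ 0 := fun h => hz (by simp [h])
  have hn : 0 < Complex.normSq z := Complex.normSq_pos.2 hz0
  -- Multiplying `z * S = -s` by the conjugate of `z` forces `S.im` to have the sign of `z.im`,
  -- whereas real roots give it the opposite sign or make it zero.
  have h2 : S.im * Complex.normSq z = s * z.im := by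
    have e1 := congrArg Complex.im h1
    have e2 := congrArg Complex.re h1
    simp at e1 e2
    rw [Complex.normSq_apply]
    linear_combination z.re * e1 - z.im * e2
  rw [hS, im_sum_inv_sub _ (fun r hr => hp.im_root hr)] at h2
  have h3 := sum_inv_normSq_nonneg p.roots z
  have h4 : z.im * (s + (p.roots.map fun r => (Complex.normSq (z - r))⁻¹).sum *
      Complex.normSq z) = 0 := by linear_combination -h2
  rcases mul_eq_zero.1 h4 with h5 | h5
  · exact hz h5
  · have := mul_nonneg h3 hn.le
    linarith

/-- `x p' + s p` is real-rooted for every real `s` if `p` has only negative zeros and is not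
constant. -/
theorem RealRooted.X_mul_derivative_add_of_neg {p : ℂ[X]} (hp : RealRooted p)
    (hneg : ∀ r ∈ p.roots, r.re < 0) (hdeg : p.roots ≠ 0) (s : ℝ) :
    RealRooted (X * derivative p + C (s : ℂ) * p) := by
  intro z hz h
  have h0 := hp z hz
  rw [eval_add, eval_mul, eval_mul, eval_C, eval_X, eval_derivative_eq_mul_sum_roots p h0] at h
  have h1 : z * (p.roots.map fun r => 1 / (z - r)).sum + s = 0 := by
    apply mul_left_cancel₀ h0
    linear_combination h
  have h2 := congrArg Complex.im h1
  rw [Complex.add_im, im_mul_sum_inv_sub _ (fun r hr => hp.im_root hr)] at h2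
  have h3 := sum_pos_of_mem (f := fun r => -(r.re * (Complex.normSq (z - r))⁻¹))
    (fun r hr => by
      have := inv_pos.2 (normSq_sub_pos hz (hp.im_root hr))
      have := mul_pos_of_neg_of_neg (hneg r hr) (neg_lt_zero.2 this)
      linarith) hdeg
  rw [Complex.ofReal_im, add_zero, Complex.zero_im] at h2
  exact (mul_ne_zero hz h3.ne') h2

/-- A real-rooted polynomial in the derivative preserves real-rootedness. -/
theorem RealRooted.aeval_derivative {p q : ℂ[X]} (hp : RealRooted p) (hq : RealRooted q)
    (hq0 : q.eval 0 ≠ 0) :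
    RealRooted (aeval (derivative : ℂ[X] →ₗ[ℂ] ℂ[X]) q p) := by
  have key : ∀ s : Multiset ℂ, (∀ r ∈ s, r.im = 0 ∧ r ≠ 0) →
      RealRooted (aeval (derivative : ℂ[X] →ₗ[ℂ] ℂ[X]) (s.map fun r => X - C r).prod p) := by
    intro s
    induction s using Multiset.induction_on with
    | empty => intro _; simpa using hp
    | cons a s ih =>
      intro hs
      obtain ⟨ha, ha0⟩ := hs a (Multiset.mem_cons_self a s)
      -- A factor `X - a` acts as `p' - a p = -a (p - a⁻¹ p')`, which is why zero must not be a root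
      -- of `q`.
      have h := (ih fun r hr => hs r (Multiset.mem_cons_of_mem hr)).add_smul_derivative
        (-a.re⁻¹)
      have har : a = (a.re : ℂ) := Complex.ext rfl (by simpa using ha)
      intro z hz h0
      apply h z hz
      rw [Multiset.map_cons, Multiset.prod_cons, map_mul] at h0
      simp only [map_sub, aeval_X, aeval_C, Module.End.mul_apply, LinearMap.sub_apply,
        Module.algebraMap_end_apply, eval_sub, eval_smul, smul_eq_mul] at h0
      rw [eval_add, eval_mul, eval_C, Complex.ofReal_neg, Complex.ofReal_inv, ← har]
      field_simp
      linear_combination -h0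
  have h := key q.roots fun r hr => ⟨hq.im_root hr, by
    rintro rfl
    exact hq0 (isRoot_of_mem_roots hr)⟩
  have hfac := (IsAlgClosed.splits q).eq_prod_roots
  intro z hz h0
  apply h z hz
  rw [hfac] at h0
  simp only [map_mul, aeval_C, Module.End.mul_apply, Module.algebraMap_end_apply, eval_smul,
    smul_eq_mul] at h0
  exact (mul_eq_zero.1 h0).resolve_left (leadingCoeff_ne_zero.2 hq.ne_zero)

/-- Off the real line a real-rooted polynomial is bounded below. -/
theorem RealRooted.le_norm_eval {p : ℂ[X]} (hp : RealRooted p) (z : ℂ) :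
    ‖p.leadingCoeff‖ * |z.im| ^ p.natDegree ≤ ‖p.eval z‖ := by
  have key : ∀ s : Multiset ℂ, (∀ r ∈ s, r.im = 0) →
      |z.im| ^ s.card ≤ ‖((s.map fun r => X - C r).prod).eval z‖ := by
    intro s
    induction s using Multiset.induction_on with
    | empty => simp
    | cons a s ih =>
      intro hs
      have h1 := ih fun r hr => hs r (Multiset.mem_cons_of_mem hr)
      rw [Multiset.card_cons, pow_succ', Multiset.map_cons, Multiset.prod_cons, eval_mul, norm_mul]
      refine mul_le_mul ?_ h1 (by positivity) (norm_nonneg _)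
      have := Complex.abs_im_le_norm (z - a)
      simpa [hs a (Multiset.mem_cons_self a s)] using this
  have hsp := IsAlgClosed.splits p
  have h := key p.roots fun r hr => hp.im_root hr
  rw [← hsp.natDegree_eq_card_roots] at h
  conv_rhs => rw [hsp.eq_prod_roots, eval_mul, eval_C, norm_mul]
  exact mul_le_mul_of_nonneg_left h (norm_nonneg _)

/-! ### Jensen polynomials and operations on their coefficient sequences -/

/-- The polynomial `∑ binom(n, j) u_j x ^ j`. -/
noncomputable def jensen (n : ℕ) (u : ℕ → ℝ) : ℂ[X] :=
  ∑ j ∈ Finset.range (n + 1), C ((n.choose j * u j : ℝ) : ℂ) * X ^ j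

theorem eval_jensen (n : ℕ) (u : ℕ → ℝ) (z : ℂ) :
    (jensen n u).eval z = ∑ j ∈ Finset.range (n + 1), ((n.choose j * u j : ℝ) : ℂ) * z ^ j := by
  simp [jensen, eval_finsetSum]

theorem coeff_jensen (n : ℕ) (u : ℕ → ℝ) (i : ℕ) :
    (jensen n u).coeff i = ((n.choose i * u i : ℝ) : ℂ) := by
  rw [jensen, finsetSum_coeff]
  simp only [coeff_C_mul_X_pow]
  rw [Finset.sum_ite_eq]
  split_ifs with h
  · rfl
  · rw [Nat.choose_eq_zero_of_lt (by simpa [Nat.lt_succ_iff] using h)]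
    simp

theorem jensen_congr {n : ℕ} {u v : ℕ → ℝ} (h : ∀ j ≤ n, u j = v j) : jensen n u = jensen n v :=
  Finset.sum_congr rfl fun j hj => by rw [h j (Nat.lt_succ_iff.1 (Finset.mem_range.1 hj))]

theorem natDegree_jensen {n : ℕ} {u : ℕ → ℝ} (h : u n ≠ 0) : (jensen n u).natDegree = n := by
  refine le_antisymm (natDegree_sum_le_of_forall_le _ _ fun j hj => ?_)
    (le_natDegree_of_ne_zero ?_)
  · exact (natDegree_C_mul_X_pow_le _ _).trans (Nat.lt_succ_iff.1 (Finset.mem_range.1 hj))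
  · rw [coeff_jensen]
    simpa using h

theorem eval_jensen_conj (n : ℕ) (u : ℕ → ℝ) (z : ℂ) :
    (jensen n u).eval (starRingEnd ℂ z) = starRingEnd ℂ ((jensen n u).eval z) := by
  simp [eval_jensen]

theorem jensen_const_mul (n : ℕ) (a : ℝ) (u : ℕ → ℝ) :
    jensen n (fun j => a * u j) = C (a : ℂ) * jensen n u := by
  ext i
  rw [coeff_C_mul, coeff_jensen, coeff_jensen]
  push_cast
  ring

theorem RealRooted.jensen_const_mul {n : ℕ} {a : ℝ} {u : ℕ → ℝ} (h : RealRooted (jensen n u))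
    (ha : a ≠ 0) : RealRooted (jensen n fun j => a * u j) := by
  intro z hz
  rw [_root_.jensen_const_mul, eval_mul, eval_C]
  exact mul_ne_zero (by exact_mod_cast ha) (h z hz)

/-- The Euler operator `x d/dx` has eigenvalue `j` on `x ^ j`. Multipliers that are linear in the
index thus become first-order differential operators. -/
theorem jensen_add_index_mul (n : ℕ) (s : ℝ) (u : ℕ → ℝ) :
    jensen n (fun j => (s + j) * u j) =
      X * derivative (jensen n u) + C (s : ℂ) * jensen n u := by
  ext i
  rw [coeff_add, coeff_C_mul, coeff_jensen, coeff_jensen]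
  rcases i with _ | i
  · simp
  · rw [coeff_X_mul, coeff_derivative, coeff_jensen]
    push_cast
    ring

theorem RealRooted.jensen_add_index_mul {n : ℕ} {u : ℕ → ℝ} (h : RealRooted (jensen n u))
    {s : ℝ} (hs : 0 < s) : RealRooted (jensen n fun j => (s + j) * u j) := by
  rw [_root_.jensen_add_index_mul]
  exact h.X_mul_derivative_add hs

theorem re_neg_of_mem_roots_jensen {n : ℕ} {u : ℕ → ℝ} (h : RealRooted (jensen n u))
    (hu : ∀ j ≤ n, 0 < u j) {r : ℂ} (hr : r ∈ (jensen n u).roots) : r.re < 0 := by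
  by_contra hneg
  have hre : r = (r.re : ℂ) := Complex.ext rfl (by simpa using h.im_root hr)
  have h0 : (jensen n u).eval r = 0 := isRoot_of_mem_roots hr
  rw [hre, eval_jensen] at h0
  have h1 : ∑ j ∈ Finset.range (n + 1), (n.choose j * u j) * r.re ^ j = 0 := by
    exact_mod_cast h0
  have h2 : 0 < ∑ j ∈ Finset.range (n + 1), (n.choose j * u j) * r.re ^ j := by
    refine Finset.sum_pos' (fun j hj => ?_) ⟨0, by simp, by simpa using hu 0 (Nat.zero_le n)⟩
    have := hu j (Nat.lt_succ_iff.1 (Finset.mem_range.1 hj))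
    have := pow_nonneg (not_lt.1 hneg) j
    positivity
  exact h2.ne' h1

/-- Positive coefficients make all zeros negative, which removes the sign restriction on `s`. The
condition `0 < n` ensures that there is at least one zero. -/
theorem RealRooted.jensen_add_index_mul_of_pos {n : ℕ} {u : ℕ → ℝ}
    (h : RealRooted (jensen n u)) (hn : 0 < n) (hu : ∀ j ≤ n, 0 < u j) (s : ℝ) :
    RealRooted (jensen n fun j => (s + j) * u j) := by
  rw [_root_.jensen_add_index_mul]
  refine h.X_mul_derivative_add_of_neg (fun r hr => re_neg_of_mem_roots_jensen h hu hr) ?_ s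
  rw [← Multiset.card_pos, ← (IsAlgClosed.splits _).natDegree_eq_card_roots,
    natDegree_jensen (hu n le_rfl).ne']
  exact hn

theorem eval_jensen_scale (n : ℕ) (u : ℕ → ℝ) (a : ℝ) (z : ℂ) :
    (jensen n fun j => a ^ j * u j).eval z = (jensen n u).eval (a * z) := by
  rw [eval_jensen, eval_jensen]
  refine Finset.sum_congr rfl fun j _ => ?_
  push_cast
  ring

theorem RealRooted.jensen_scale {n : ℕ} {u : ℕ → ℝ} (h : RealRooted (jensen n u)) {a : ℝ}
    (ha : a ≠ 0) : RealRooted (jensen n fun j => a ^ j * u j) := by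
  intro z hz
  rw [eval_jensen_scale]
  exact h _ (by simpa using ⟨ha, hz⟩)

theorem eval_jensen_reverse (n : ℕ) (u : ℕ → ℝ) {z : ℂ} (hz : z ≠ 0) :
    (jensen n fun j => u (n - j)).eval z = z ^ n * (jensen n u).eval z⁻¹ := by
  rw [eval_jensen, eval_jensen, ← Finset.sum_flip, Finset.mul_sum]
  refine Finset.sum_congr rfl fun j hj => ?_
  have hj : j ≤ n := Nat.lt_succ_iff.1 (Finset.mem_range.1 hj)
  rw [Nat.choose_symm hj, Nat.sub_sub_self hj, pow_sub₀ _ hz hj, inv_pow]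
  ring

theorem RealRooted.jensen_reverse {n : ℕ} {u : ℕ → ℝ} (h : RealRooted (jensen n u)) :
    RealRooted (jensen n fun j => u (n - j)) := by
  intro z hz
  have hz0 : z ≠ 0 := fun h => hz (by simp [h])
  rw [eval_jensen_reverse n u hz0]
  refine mul_ne_zero (pow_ne_zero _ hz0) (h _ ?_)
  rw [Complex.inv_im]
  exact div_ne_zero (neg_ne_zero.2 hz) (Complex.normSq_pos.2 hz0).ne'

theorem RealRooted.of_jensen_reverse {n : ℕ} {u : ℕ → ℝ}
    (h : RealRooted (jensen n fun j => u (n - j))) : RealRooted (jensen n u) := by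
  have := h.jensen_reverse
  rwa [jensen_congr (v := u) fun j hj => by rw [Nat.sub_sub_self hj]] at this

-- This plays the role of Hurwitz's theorem. The lower bound `|u m n| * |im z| ^ n` passes to the
-- limit and stays positive because `v n ≠ 0`.
open Filter Topology in
theorem RealRooted.jensen_of_tendsto {n : ℕ} {u : ℕ → ℕ → ℝ} {v : ℕ → ℝ}
    (h : ∀ᶠ m in atTop, RealRooted (jensen n (u m)))
    (hlim : ∀ j, Tendsto (fun m => u m j) atTop (𝓝 (v j))) (hv : v n ≠ 0) :
    RealRooted (jensen n v) := by
  intro z hz h0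
  have hl : Tendsto (fun m => ‖(jensen n (u m)).eval z‖) atTop (𝓝 ‖(jensen n v).eval z‖) := by
    simp only [eval_jensen]
    refine (tendsto_finsetSum _ fun j _ => ?_).norm
    exact (((Complex.continuous_ofReal.tendsto _).comp ((hlim j).const_mul _))).mul_const _
  have hb : Tendsto (fun m => |u m n| * |z.im| ^ n) atTop (𝓝 (|v n| * |z.im| ^ n)) :=
    (hlim n).abs.mul_const _
  have hle := le_of_tendsto_of_tendsto hb hl (h.mono fun m hm => ?_)
  · rw [h0, norm_zero] at hle
    have : 0 < |v n| * |z.im| ^ n := by positivity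
    linarith
  -- If the top coefficient vanishes the degree drops, but then the required bound is trivial.
  · by_cases hu : u m n = 0
    · simp [hu]
    · have := hm.le_norm_eval z
      rwa [leadingCoeff, natDegree_jensen hu, coeff_jensen, Nat.choose_self, Nat.cast_one, one_mul,
        Complex.norm_real, Real.norm_eq_abs] at this

theorem realRooted_jensen_one (n : ℕ) : RealRooted (jensen n fun _ => 1) := by
  intro z hz
  have : (jensen n fun _ => 1).eval z = (z + 1) ^ n := by
    rw [eval_jensen, add_pow]
    exact Finset.sum_congr rfl fun j _ => by simp; ring
  rw [this]
  refine pow_ne_zero _ fun h => hz ?_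
  simpa using congrArg Complex.im h

/-! ### Additive convolution -/

/-- Binomial convolution of sequences. -/
def binomConv (u v : ℕ → ℝ) (i : ℕ) : ℝ :=
  ∑ ab ∈ Finset.HasAntidiagonal.antidiagonal i, i.choose ab.1 * (u ab.1 * v ab.2)

/-- Links Hermite–Poulain operators to convolution. Differentiation shifts indices down, hence the
reversal of `v`. The `a!` produced by `a` derivatives joins `binom(m, a)` to form the falling
factorial of `m`. -/
theorem aeval_derivative_jensen {n m : ℕ} (hnm : n ≤ m) (u v : ℕ → ℝ) :
    aeval (derivative : ℂ[X] →ₗ[ℂ] ℂ[X]) (jensen m u) (jensen n fun j => v (n - j)) =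
      jensen n fun j => binomConv (fun a => m.descFactorial a * u a) v (n - j) := by
  ext j
  rw [jensen, map_sum, LinearMap.sum_apply, finsetSum_coeff, coeff_jensen]
  simp only [map_mul, aeval_C, aeval_X_pow, Module.End.mul_apply, Module.algebraMap_end_apply,
    coeff_smul, Module.End.pow_apply, coeff_iterate_derivative, coeff_jensen, smul_eq_mul,
    nsmul_eq_mul]
  rw [binomConv, Finset.Nat.sum_antidiagonal_eq_sum_range_succ
    (f := fun a b => ((n - j).choose a : ℝ) * (m.descFactorial a * u a * v b))]
  rw [← Finset.sum_subset (Finset.range_mono (show (n - j) + 1 ≤ m + 1 by omega))]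
  · push_cast
    rw [Finset.mul_sum]
    refine Finset.sum_congr rfl fun a ha => ?_
    have ha : a ≤ n - j := Nat.lt_succ_iff.1 (Finset.mem_range.1 ha)
    have e1 : n - (j + a) = n - j - a := by omega
    rw [e1, Nat.descFactorial_eq_factorial_mul_choose, Nat.descFactorial_eq_factorial_mul_choose]
    have e2 : (n.choose (j + a) : ℂ) * ((j + a).choose a) = n.choose j * (n - j).choose a := by
      by_cases hj : j ≤ n
      · have := Nat.choose_mul (n := n) (show j ≤ j + a by omega)
        rw [Nat.add_sub_cancel_left, Nat.choose_symm_add] at this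
        exact_mod_cast this
      · rw [Nat.choose_eq_zero_of_lt (show n < j by omega),
          Nat.choose_eq_zero_of_lt (show n < j + a by omega)]
        simp
    push_cast
    linear_combination (m.choose a : ℂ) * u a * a.factorial * v (n - j - a) * e2
  · intro a _ ha
    rw [Nat.choose_eq_zero_of_lt (show n < j + a by simp at ha; omega)]
    simp

open Filter Topology in
theorem tendsto_descFactorial_div_pow (a : ℕ) :
    Tendsto (fun m : ℕ => (m.descFactorial a : ℝ) * ((m : ℝ)⁻¹) ^ a) atTop (𝓝 1) := by
  induction a with
  | zero => simp
  | succ a ih =>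
    have h1 : Tendsto (fun m : ℕ => 1 - (a : ℝ) * (m : ℝ)⁻¹) atTop (𝓝 (1 - a * 0)) :=
      (tendsto_inv_atTop_nhds_zero_nat.const_mul _).const_sub _
    have h2 := h1.mul ih
    rw [mul_zero, sub_zero, one_mul] at h2
    refine h2.congr' ?_
    filter_upwards [eventually_ge_atTop (a + 1)] with m hm
    have hm0 : (m : ℝ) ≠ 0 := by
      have : m ≠ 0 := by omega
      exact_mod_cast this
    rw [Nat.descFactorial_succ, Nat.cast_mul, Nat.cast_sub (by omega)]
    rw [pow_succ]
    field_simp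

open Filter Topology in
/-- Convolution with a sequence all of whose Jensen polynomials are real-rooted. -/
theorem RealRooted.jensen_binomConv {n : ℕ} {u v : ℕ → ℝ}
    (hu : ∀ m, RealRooted (jensen m u)) (hu0 : u 0 ≠ 0) (hv : RealRooted (jensen n v))
    (hv0 : v 0 ≠ 0) : RealRooted (jensen n (binomConv u v)) := by
  apply RealRooted.of_jensen_reverse
  -- Rescaling the variable by `1 / m` contributes `m ^ (-a)`, so the spurious falling factorial
  -- tends to one as `m` grows.
  refine RealRooted.jensen_of_tendsto
    (u := fun m j => binomConv (fun a => m.descFactorial a * ((m : ℝ)⁻¹ ^ a * u a)) v (n - j))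
    ?_ ?_ ?_
  · filter_upwards [eventually_ge_atTop (n + 1)] with m hm
    rw [← aeval_derivative_jensen (by omega)]
    have hm0 : (m : ℝ)⁻¹ ≠ 0 := by
      have : m ≠ 0 := by omega
      simpa using this
    refine hv.jensen_reverse.aeval_derivative ((hu m).jensen_scale hm0) ?_
    rw [← coeff_zero_eq_eval_zero, coeff_jensen]
    simpa using hu0
  · intro j
    refine tendsto_finsetSum _ fun ab _ => Tendsto.const_mul _ (Tendsto.mul_const _ ?_)
    have := (tendsto_descFactorial_div_pow ab.1).mul_const (u ab.1)
    rw [one_mul] at this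
    exact this.congr fun m => by ring
  -- The top coefficient of the reversed limit is the convolution at index `0`, namely `u 0 * v 0`.
  · simpa [binomConv] using ⟨hu0, hv0⟩

/-! ### Multiplicative convolution -/

/-- The linear functional `X ^ i ↦ g i`. -/
noncomputable def seqFunctional (g : ℕ → ℂ) : ℂ[X] →ₗ[ℂ] ℂ :=
  Polynomial.lsum fun i => g i • LinearMap.id

theorem seqFunctional_monomial (g : ℕ → ℂ) (i : ℕ) (a : ℂ) :
    seqFunctional g (monomial i a) = a * g i := by
  simp [seqFunctional, mul_comm]

/-- Absorbing one linear factor into the functional replaces `g` by `g_i + w g_(i+1)`, the sequence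
of a polar derivative. This drives the induction in Grace's theorem. -/
theorem seqFunctional_one_add_mul (g : ℕ → ℂ) (w : ℂ) (p : ℂ[X]) :
    seqFunctional g ((1 + C w * X) * p) = seqFunctional (fun i => g i + w * g (i + 1)) p := by
  induction p using Polynomial.induction_on' with
  | add p q hp hq => rw [mul_add, map_add, map_add, hp, hq]
  | monomial i a =>
    rw [add_mul, one_mul, map_add, mul_assoc, X_mul_monomial, C_mul_monomial,
      seqFunctional_monomial, seqFunctional_monomial, seqFunctional_monomial]
    ring

/-- The polynomial `∑ binom(n, j) g_j x ^ j` with complex `g`. -/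
noncomputable def complexJensen (n : ℕ) (g : ℕ → ℂ) : ℂ[X] :=
  ∑ j ∈ Finset.range (n + 1), C (n.choose j * g j) * X ^ j

theorem coeff_complexJensen (n : ℕ) (g : ℕ → ℂ) (i : ℕ) :
    (complexJensen n g).coeff i = n.choose i * g i := by
  rw [complexJensen, finsetSum_coeff]
  simp only [coeff_C_mul_X_pow]
  rw [Finset.sum_ite_eq]
  split_ifs with h
  · rfl
  · rw [Nat.choose_eq_zero_of_lt (by simpa [Nat.lt_succ_iff] using h)]
    simp

theorem complexJensen_ofReal (n : ℕ) (u : ℕ → ℝ) :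
    complexJensen n (fun j => (u j : ℂ)) = jensen n u := by
  ext i
  rw [coeff_complexJensen, coeff_jensen]
  push_cast
  rfl

theorem natDegree_complexJensen_le (n : ℕ) (g : ℕ → ℂ) : (complexJensen n g).natDegree ≤ n :=
  natDegree_sum_le_of_forall_le _ _ fun _ hj =>
    (natDegree_C_mul_X_pow_le _ _).trans (Nat.lt_succ_iff.1 (Finset.mem_range.1 hj))

/-- Identifies the sequence `g_i + w g_(i+1)` with the polar derivative `(n + 1) p - (x - w) p'`, to
which Laguerre's argument applies. -/
theorem complexJensen_polar (n : ℕ) (g : ℕ → ℂ) (w : ℂ) :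
    C (n + 1 : ℂ) * complexJensen n (fun i => g i + w * g (i + 1)) =
      C (n + 1 : ℂ) * complexJensen (n + 1) g -
        (X - C w) * derivative (complexJensen (n + 1) g) := by
  have e1 : ∀ i : ℕ, ((n + 1 : ℂ)) * n.choose i = (n + 1).choose (i + 1) * (i + 1) := by
    intro i
    exact_mod_cast Nat.add_one_mul_choose_eq n i
  ext i
  rw [sub_mul, coeff_sub, coeff_sub, coeff_C_mul, coeff_C_mul, coeff_C_mul, coeff_complexJensen,
    coeff_complexJensen, coeff_derivative, coeff_complexJensen]
  rcases i with _ | i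
  · have := e1 0
    simp at this ⊢
    ring
  · rw [coeff_X_mul, coeff_derivative, coeff_complexJensen]
    have h1 := e1 (i + 1)
    have h2 : ((n + 1).choose (i + 1) : ℂ) = n.choose i + n.choose (i + 1) := by
      exact_mod_cast Nat.choose_succ_succ n i
    have h3 := e1 i
    push_cast at h1 ⊢
    rw [h2] at h3 ⊢
    linear_combination w * g (i + 1 + 1) * h1 - g (i + 1) * h3

/-- The disc condition on the values `1 / (z - r)` with `im r ≤ 0`, summed along a tangent. -/
theorem im_sum_inv_sub_le (s : Multiset ℂ) {z : ℂ} (hz : 0 < z.im) (hs : ∀ r ∈ s, r.im ≤ 0)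
    (m : ℂ) :
    z.im * (2 * ((s.map fun r => 1 / (z - r)).sum * starRingEnd ℂ m).re
        - s.card * Complex.normSq m) ≤ -(s.map fun r => 1 / (z - r)).sum.im := by
  induction s using Multiset.induction_on with
  | empty => simp
  | cons a s ih =>
    have ih := ih fun r hr => hs r (Multiset.mem_cons_of_mem hr)
    have ha := hs a (Multiset.mem_cons_self a s)
    rw [Multiset.map_cons, Multiset.sum_cons, Multiset.card_cons, Complex.add_im, add_mul,
      Complex.add_re]
    push_cast
    set v := 1 / (z - a) with hv
    have h1 : z.im * Complex.normSq v ≤ -v.im := by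
      rw [hv, one_div, Complex.normSq_inv, Complex.inv_im, ← div_eq_mul_inv, neg_div, neg_neg,
        Complex.sub_im]
      exact div_le_div_of_nonneg_right (by linarith) (Complex.normSq_nonneg _)
    -- The value `v` lies in the disc `z.im * |v|² ≤ -v.im`. Bounding `|v|²` below by its tangent at
    -- `m` makes the inequality linear in `v`, so it can be summed over the roots.
    have h2 : 2 * (v * starRingEnd ℂ m).re - Complex.normSq m ≤ Complex.normSq v := by
      have := Complex.normSq_nonneg (v - m)
      rw [Complex.normSq_sub] at this
      linarith
    have h3 := mul_le_mul_of_nonneg_left h2 hz.le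
    linarith

/-- Laguerre's theorem on polar derivatives for the upper half-plane. -/
theorem complexJensen_polar_ne_zero {n : ℕ} {g : ℕ → ℂ}
    (hg : ∀ z : ℂ, 0 < z.im → (complexJensen (n + 1) g).eval z ≠ 0) {w : ℂ} (hw : 0 < w.im)
    {z : ℂ} (hz : 0 < z.im) :
    (complexJensen n fun i => g i + w * g (i + 1)).eval z ≠ 0 := by
  intro h0
  have hp := hg z hz
  set p := complexJensen (n + 1) g with hpdef
  have h := congrArg (eval z) (complexJensen_polar n g w)
  rw [eval_mul, h0, mul_zero, eval_sub, eval_mul, eval_mul, eval_C, eval_sub, eval_X, eval_C,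
    ← hpdef, eval_derivative_eq_mul_sum_roots p hp] at h
  -- A zero of the polar derivative means `S = (n + 1) / (z - w)`, so the tangent is taken at `m = 1
  -- / (z - w)`. With at most `n + 1` roots this yields `z.im ≤ z.im - w.im`, contradicting `0 <
  -- w.im`.
  have hs := im_sum_inv_sub_le p.roots hz (fun r hr => by
    by_contra hr'
    exact hg r (not_le.1 hr') (isRoot_of_mem_roots hr)) (1 / (z - w))
  set S := (p.roots.map fun r => 1 / (z - r)).sum
  have h1 : (z - w) * S = n + 1 := by
    apply mul_left_cancel₀ hp
    linear_combination h
  have hzw : z - w ≠ 0 := by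
    intro h
    rw [h, zero_mul] at h1
    exact Nat.cast_add_one_ne_zero n h1.symm
  set m := 1 / (z - w) with hm
  have hS : S = ((n + 1 : ℝ) : ℂ) * m := by
    rw [hm]
    field_simp
    push_cast
    linear_combination h1
  have hmm : (S * starRingEnd ℂ m).re = (n + 1) * Complex.normSq m := by
    rw [hS, mul_assoc, Complex.mul_conj, Complex.re_ofReal_mul, Complex.ofReal_re]
  have hcard : (p.roots.card : ℝ) ≤ n + 1 := by
    exact_mod_cast (card_roots' p).trans (natDegree_complexJensen_le (n + 1) g)
  have him : -m.im = (z.im - w.im) * Complex.normSq m := by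
    rw [hm, one_div, Complex.normSq_inv, Complex.inv_im, Complex.sub_im]
    ring
  have hpos : 0 < Complex.normSq m := Complex.normSq_pos.2 (by rw [hm]; exact one_div_ne_zero hzw)
  rw [hmm, hS, Complex.im_ofReal_mul] at hs
  have h5 := mul_le_mul_of_nonneg_right hcard hpos.le
  have h6 := mul_le_mul_of_nonneg_left h5 hz.le
  have h7 : 0 < (n + 1 : ℝ) * (w.im * Complex.normSq m) := by positivity
  have h8 : -((n + 1 : ℝ) * m.im) = (n + 1) * ((z.im - w.im) * Complex.normSq m) := by
    rw [← him]; ring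
  linarith

/-- The Grace–Walsh–Szegő theorem for the upper half-plane. -/
theorem seqFunctional_prod_ne_zero (s : Multiset ℂ) (hs : ∀ w ∈ s, 0 < w.im) (g : ℕ → ℂ)
    (hg : ∀ z : ℂ, 0 < z.im → (complexJensen s.card g).eval z ≠ 0) :
    seqFunctional g (s.map fun w => 1 + C w * X).prod ≠ 0 := by
  induction s using Multiset.induction_on generalizing g with
  | empty =>
    have := hg Complex.I (by simp)
    rw [Multiset.map_zero, Multiset.prod_zero, ← monomial_zero_one, seqFunctional_monomial]
    simpa [complexJensen] using this
  | cons a s ih =>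
    rw [Multiset.map_cons, Multiset.prod_cons, seqFunctional_one_add_mul]
    refine ih (fun w hw => hs w (Multiset.mem_cons_of_mem hw)) _ fun z hz => ?_
    rw [Multiset.card_cons] at hg
    exact complexJensen_polar_ne_zero hg (hs a (Multiset.mem_cons_self a s)) hz

/-- Szegő's composition theorem. -/
theorem RealRooted.jensen_mul {n : ℕ} {u g : ℕ → ℝ} (hu : RealRooted (jensen n u))
    (hpos : ∀ j ≤ n, 0 < u j) (hg : RealRooted (jensen n g)) :
    RealRooted (jensen n fun j => u j * g j) := by
  have key : ∀ z : ℂ, 0 < z.im → (jensen n fun j => u j * g j).eval z ≠ 0 := by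
    intro z hz
    set f := jensen n u with hf
    have hdeg : f.natDegree = n := natDegree_jensen (hpos n le_rfl).ne'
    have hsp := IsAlgClosed.splits f
    have h0 : ∀ r ∈ f.roots, r ≠ 0 := fun r hr h => by
      have := re_neg_of_mem_roots_jensen hu hpos hr
      simp [h] at this
    -- Writing `f(zX)` through factors `1 + w X` gives `w = -z / r`. As `r < 0`, each `w` lies in
    -- the upper half-plane with `z`, as Grace's theorem requires.
    have hcomp : f.comp (C z * X) = C (f.leadingCoeff * (f.roots.map fun r => -r).prod) *
        ((f.roots.map fun r => -z / r).map fun w => 1 + C w * X).prod := by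
      conv_lhs => rw [hsp.eq_prod_roots]
      rw [mul_comp, C_comp, C_mul, mul_assoc, ← coe_compRingHom_apply, map_multiset_prod,
        map_multiset_prod, Multiset.map_map, Multiset.map_map, Multiset.map_map,
        ← Multiset.prod_map_mul]
      congr 2
      refine Multiset.map_congr rfl fun r hr => ?_
      have := h0 r hr
      simp only [Function.comp_apply, coe_compRingHom_apply, sub_comp, X_comp, C_comp]
      rw [mul_add, ← mul_assoc, ← C_mul, show -r * (-z / r) = z by field_simp]
      simp
      ring
    have hL : seqFunctional (fun j => (g j : ℂ)) (f.comp (C z * X)) =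
        (jensen n fun j => u j * g j).eval z := by
      rw [hf, jensen, Polynomial.sum_comp, map_sum, eval_jensen]
      refine Finset.sum_congr rfl fun j _ => ?_
      rw [mul_comp, C_comp, X_pow_comp, mul_pow, ← C_pow, ← mul_assoc, ← C_mul,
        C_mul_X_pow_eq_monomial, seqFunctional_monomial]
      push_cast
      ring
    rw [← hL, hcomp, ← smul_eq_C_mul, map_smul, smul_eq_mul]
    refine mul_ne_zero (mul_ne_zero (leadingCoeff_ne_zero.2 hu.ne_zero) ?_) ?_
    · refine Multiset.prod_ne_zero fun h => ?_
      obtain ⟨r, hr, h⟩ := Multiset.mem_map.1 h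
      exact h0 r hr (neg_eq_zero.1 h)
    · refine seqFunctional_prod_ne_zero _ (fun w hw => ?_) _ fun x hx => ?_
      · obtain ⟨r, hr, rfl⟩ := Multiset.mem_map.1 hw
        have h1 := re_neg_of_mem_roots_jensen hu hpos hr
        have hre : r = (r.re : ℂ) := Complex.ext rfl (by simpa using hu.im_root hr)
        rw [hre, Complex.div_ofReal_im, Complex.neg_im]
        exact div_pos_of_neg_of_neg (by linarith) h1
      · rw [Multiset.card_map, ← hsp.natDegree_eq_card_roots, hdeg, complexJensen_ofReal]
        exact hg x hx.ne'
  intro z hz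
  rcases lt_or_gt_of_ne hz with h1 | h1
  · intro h0
    refine key (starRingEnd ℂ z) (by simpa using h1) ?_
    rw [eval_jensen_conj, h0, map_zero]
  · exact key z h1

/-! ### Rising factorials -/

theorem risingFactorial_zero (a : ℝ) : risingFactorial a 0 = 1 := by simp [risingFactorial]

theorem risingFactorial_succ (a : ℝ) (j : ℕ) :
    risingFactorial a (j + 1) = risingFactorial a j * (a + j) :=
  ascPochhammer_succ_eval j a

theorem risingFactorial_add (a : ℝ) (i j : ℕ) :
    risingFactorial a (i + j) = risingFactorial a i * risingFactorial (a + i) j := by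
  induction j with
  | zero => simp [risingFactorial_zero]
  | succ j ih =>
    rw [← add_assoc, risingFactorial_succ, risingFactorial_succ, ih]
    push_cast
    ring

theorem risingFactorial_one (a : ℝ) : risingFactorial a 1 = a := by
  simp [risingFactorial]

theorem risingFactorial_pos {a : ℝ} (ha : 0 < a) (j : ℕ) : 0 < risingFactorial a j :=
  ascPochhammer_pos j a ha

/-- For `a > -1` only the first factor `a` can fail to be positive. -/
theorem risingFactorial_ne_zero {a : ℝ} (ha : -1 < a) (ha0 : a ≠ 0) (j : ℕ) :
    risingFactorial a j ≠ 0 := by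
  induction j with
  | zero => simp [risingFactorial_zero]
  | succ j ih =>
    rw [risingFactorial_succ]
    refine mul_ne_zero ih ?_
    rcases j with _ | j
    · simpa using ha0
    · have : (0 : ℝ) ≤ j := j.cast_nonneg
      push_cast
      linarith

theorem risingFactorial_reflect (a : ℝ) (j : ℕ) :
    risingFactorial (1 - a - j) j = (-1) ^ j * risingFactorial a j := by
  have := ascPochhammer_eval_neg_eq_descPochhammer ℝ (a + (j : ℝ) - 1) j
  rw [descPochhammer_eval_eq_ascPochhammer, show -(a + (j : ℝ) - 1) = 1 - a - j by ring,
    show a + (j : ℝ) - 1 - j + 1 = a by ring] at this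
  exact this

theorem risingFactorial_two_mul (x : ℝ) (i : ℕ) :
    risingFactorial (2 * x) (2 * i) =
      4 ^ i * (risingFactorial x i * risingFactorial (x + 1 / 2) i) := by
  induction i with
  | zero => simp [risingFactorial_zero]
  | succ i ih =>
    rw [show 2 * (i + 1) = 2 * i + 1 + 1 by ring, risingFactorial_succ, risingFactorial_succ, ih,
      risingFactorial_succ, risingFactorial_succ]
    push_cast
    ring

-- This is Chu–Vandermonde: the rising factorials written this way are the falling factorials of
-- `x`, `y` and `x + y`.
open Finset.HasAntidiagonal in
theorem sum_choose_mul_risingFactorial (x y : ℝ) (i : ℕ) :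
    ∑ ab ∈ antidiagonal i, (i.choose ab.1 : ℝ) *
      (risingFactorial (x - ab.1 + 1) ab.1 * risingFactorial (y - ab.2 + 1) ab.2) =
    risingFactorial (x + y - i + 1) i := by
  have h := Ring.descPochhammer_smeval_add i (Commute.all x y)
  simp only [Polynomial.descPochhammer_smeval_eq_ascPochhammer, Polynomial.ascPochhammer_smeval_eq_eval] at h
  exact h.symm

open Filter Topology in
theorem tendsto_risingFactorial_div_pow (s : ℝ) (j : ℕ) :
    Tendsto (fun m : ℕ => ((m : ℝ)⁻¹) ^ j * risingFactorial (s + m) j) atTop (𝓝 1) := by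
  induction j with
  | zero => simp [risingFactorial_zero]
  | succ j ih =>
    have h1 : Tendsto (fun m : ℕ => (s + j) * (m : ℝ)⁻¹ + 1) atTop (𝓝 ((s + j) * 0 + 1)) :=
      (tendsto_inv_atTop_nhds_zero_nat.const_mul _).add_const _
    have h2 := ih.mul h1
    rw [mul_zero, zero_add, one_mul] at h2
    refine h2.congr' ?_
    filter_upwards [eventually_ge_atTop 1] with m hm
    have hm0 : (m : ℝ) ≠ 0 := by
      have : m ≠ 0 := by omega
      exact_mod_cast this
    have : (s + j) * (m : ℝ)⁻¹ + 1 = (m : ℝ)⁻¹ * (s + m + j) := by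
      field_simp
      ring
    rw [risingFactorial_succ, this]
    ring

/-! ### Multiplier sequences -/

theorem RealRooted.jensen_risingFactorial_mul {n : ℕ} {u : ℕ → ℝ} (h : RealRooted (jensen n u))
    {s : ℝ} (hs : 0 < s) (m : ℕ) :
    RealRooted (jensen n fun j => risingFactorial (s + j) m * u j) := by
  induction m with
  | zero => simpa [risingFactorial_zero] using h
  | succ m ih =>
    have := ih.jensen_add_index_mul (s := s + m) (by positivity)
    rwa [jensen_congr fun j _ => ?_] at this
    rw [risingFactorial_succ]
    ring

-- From `(s)_m (s + m)_j = (s)_j (s + j)_m` one gets `m ^ (-j) (s + j)_m / (s)_m → 1 / (s)_j`. The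
-- multiplier is a limit of products of linear ones.
open Filter Topology in
theorem RealRooted.jensen_div_risingFactorial {n : ℕ} {u : ℕ → ℝ} (h : RealRooted (jensen n u))
    (hu : u n ≠ 0) {s : ℝ} (hs : 0 < s) :
    RealRooted (jensen n fun j => u j / risingFactorial s j) := by
  have hr := fun j => (risingFactorial_pos hs j).ne'
  refine RealRooted.jensen_of_tendsto
    (u := fun m j => (m : ℝ)⁻¹ ^ j *
      ((risingFactorial s m)⁻¹ * (risingFactorial (s + j) m * u j))) ?_ (fun j => ?_)
    (div_ne_zero hu (hr n))
  · filter_upwards [eventually_ge_atTop 1] with m hm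
    have hm0 : (m : ℝ)⁻¹ ≠ 0 := by
      have : m ≠ 0 := by omega
      simpa using this
    exact ((h.jensen_risingFactorial_mul hs m).jensen_const_mul (inv_ne_zero (hr m))).jensen_scale
      hm0
  · have := (tendsto_risingFactorial_div_pow s j).mul_const (u j / risingFactorial s j)
    rw [one_mul] at this
    refine this.congr fun m => ?_
    have e := risingFactorial_add s m j
    rw [add_comm, risingFactorial_add] at e
    have h1 := hr m
    have h2 := hr j
    field_simp
    linear_combination -((m : ℝ)⁻¹ ^ j * u j) * e

/-- For `-1 < s < 0`, write `1 / (s)_j = (s + j) / (s (s + 1)_j)`. The sequence `1 / (s + 1)_j` is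
positive, so a linear multiplier with negative `s` is allowed. -/
theorem realRooted_jensen_inv_risingFactorial {s : ℝ} (hs : -1 < s) (hs0 : s ≠ 0) (n : ℕ) :
    RealRooted (jensen n fun j => (risingFactorial s j)⁻¹) := by
  have hpos : ∀ {s : ℝ}, 0 < s → RealRooted (jensen n fun j => (risingFactorial s j)⁻¹) := by
    intro s hs
    simpa only [one_div] using
      (realRooted_jensen_one n).jensen_div_risingFactorial one_ne_zero hs
  rcases lt_or_gt_of_ne hs0 with h | h
  · rcases Nat.eq_zero_or_pos n with rfl | hn
    · intro z _
      simp [jensen, risingFactorial_zero]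
    have h1 : 0 < s + 1 := by linarith
    have := ((hpos h1).jensen_add_index_mul_of_pos hn
      (fun j _ => inv_pos.2 (risingFactorial_pos h1 j)) s).jensen_const_mul (inv_ne_zero hs0)
    rwa [jensen_congr fun j _ => ?_] at this
    have e := risingFactorial_add s 1 j
    rw [add_comm, risingFactorial_succ, risingFactorial_one, Nat.cast_one] at e
    have h2 := risingFactorial_ne_zero hs hs0 j
    have h3 := (risingFactorial_pos h1 j).ne'
    field_simp
    linear_combination e
  · exact hpos h

/-- The coefficients of the product of two confluent hypergeometric functions `₀F₁`. -/
theorem binomConv_inv_risingFactorial {p q : ℝ} (hp : -1 < p) (hp0 : p ≠ 0) (hq : -1 < q)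
    (hq0 : q ≠ 0) (i : ℕ) :
    binomConv (fun a => (risingFactorial p a)⁻¹) (fun b => (risingFactorial q b)⁻¹) i =
      risingFactorial (p + q - 1 + i) i / (risingFactorial p i * risingFactorial q i) := by
  have hpn := risingFactorial_ne_zero hp hp0
  have hqn := risingFactorial_ne_zero hq hq0
  -- Clearing denominators leaves `(p + a)_b (q + b)_a` with `a + b = i`. These are falling
  -- factorials of `p + i - 1` and `q + i - 1`, which dictates the arguments.
  have h := sum_choose_mul_risingFactorial (q + i - 1) (p + i - 1) i
  rw [show q + i - 1 + (p + i - 1) - i + 1 = p + q - 1 + i by ring] at h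
  rw [eq_div_iff (mul_ne_zero (hpn i) (hqn i)), ← h, binomConv, Finset.sum_mul]
  refine Finset.sum_congr rfl fun ab hab => ?_
  have hab := Finset.HasAntidiagonal.mem_antidiagonal.1 hab
  have hc : (i : ℝ) = ab.1 + ab.2 := by exact_mod_cast hab.symm
  have e1 := risingFactorial_add p ab.1 ab.2
  have e2 := risingFactorial_add q ab.2 ab.1
  rw [hab] at e1
  rw [add_comm, hab] at e2
  rw [e1, e2, show q + i - 1 - ab.1 + 1 = q + ab.2 by rw [hc]; ring,
    show p + i - 1 - ab.2 + 1 = p + ab.1 by rw [hc]; ring]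
  have h1 := hpn ab.1
  have h2 := hqn ab.2
  field_simp

theorem realRooted_jensen_bessel_mul {p q : ℝ} (hp : -1 < p) (hp0 : p ≠ 0) (hq : -1 < q)
    (hq0 : q ≠ 0) (n : ℕ) :
    RealRooted (jensen n fun i =>
      risingFactorial (p + q - 1 + i) i / (risingFactorial p i * risingFactorial q i)) := by
  have := RealRooted.jensen_binomConv (realRooted_jensen_inv_risingFactorial hp hp0)
    (by simp [risingFactorial_zero]) (realRooted_jensen_inv_risingFactorial hq hq0 n)
    (by simp [risingFactorial_zero])
  rwa [jensen_congr fun j _ => binomConv_inv_risingFactorial hp hp0 hq hq0 j] at this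

/-- A Laguerre polynomial in terms of falling factorials. -/
theorem realRooted_jensen_falling {n : ℕ} {t : ℝ} (ht : (n : ℝ) - 2 < t) (ht' : t ≠ n - 1) :
    RealRooted (jensen n fun l => risingFactorial (t - l + 1) l) := by
  have h1 : -1 < t - n + 1 := by linarith
  have h2 : t - n + 1 ≠ 0 := fun h => ht' (by linarith)
  apply RealRooted.of_jensen_reverse
  have := (realRooted_jensen_inv_risingFactorial h1 h2 n).jensen_const_mul
    (risingFactorial_ne_zero h1 h2 n)
  rwa [jensen_congr fun j hj => ?_] at this
  have e := risingFactorial_add (t - n + 1) j (n - j)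
  rw [Nat.add_sub_cancel' hj] at e
  rw [e, Nat.cast_sub hj, show t - ((n : ℝ) - j) + 1 = t - n + 1 + j by ring]
  have := risingFactorial_ne_zero h1 h2 j
  field_simp

/-- A Jacobi polynomial. -/
theorem realRooted_jensen_jacobi {n : ℕ} {c t : ℝ} (hc : 0 < c) (ht : (n : ℝ) - 2 < t)
    (ht' : t ≠ n - 1) :
    RealRooted (jensen n fun i => risingFactorial (c + t) i / risingFactorial c i) := by
  have hne : risingFactorial (t - n + 1) n ≠ 0 :=
    risingFactorial_ne_zero (by linarith) (fun h => ht' (by linarith)) n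
  have h1 := (realRooted_jensen_falling ht ht').jensen_div_risingFactorial hne hc
  -- Convolution with the constant sequence is multiplication of the exponential generating function
  -- by `exp`. Chu–Vandermonde then sums the coefficients.
  have := RealRooted.jensen_binomConv realRooted_jensen_one one_ne_zero h1
    (by simp [risingFactorial_zero])
  rwa [jensen_congr fun i _ => ?_] at this
  have hcn := fun j => (risingFactorial_pos hc j).ne'
  have h := sum_choose_mul_risingFactorial (c + i - 1) t i
  rw [show c + i - 1 + t - i + 1 = c + t by ring] at h
  rw [eq_div_iff (hcn i), ← h, binomConv, Finset.sum_mul]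
  refine Finset.sum_congr rfl fun ab hab => ?_
  have hab := Finset.HasAntidiagonal.mem_antidiagonal.1 hab
  have hc : (i : ℝ) = ab.1 + ab.2 := by exact_mod_cast hab.symm
  have e1 := risingFactorial_add c ab.2 ab.1
  rw [add_comm, hab] at e1
  rw [e1, show c + i - 1 - ab.1 + 1 = c + ab.2 by rw [hc]; ring]
  have h2 := hcn ab.2
  field_simp

/-- The multiplier `(c + t)_i / (c)_i` on polynomials with negative zeros. -/
theorem RealRooted.jensen_mul_jacobi {n : ℕ} {u : ℕ → ℝ} (h : RealRooted (jensen n u))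
    (hu : ∀ j ≤ n, 0 < u j) {c t : ℝ} (hc : 0 < c) (ht : t ∈ zSet n ∨ (n : ℝ) - 2 < t) :
    RealRooted (jensen n fun i => u i * (risingFactorial (c + t) i / risingFactorial c i)) := by
  -- For natural `t` the multiplier equals `(c + i)_t / (c)_t`, a product of linear ones. Otherwise
  -- Szegő's composition with a Jacobi polynomial applies, and the excluded value `t = n - 1` does
  -- not occur.
  by_cases hz : ∃ m : ℕ, t = m
  · obtain ⟨m, rfl⟩ := hz
    have := (h.jensen_risingFactorial_mul hc m).jensen_const_mul
      (inv_ne_zero (risingFactorial_pos hc m).ne')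
    rwa [jensen_congr fun i _ => ?_] at this
    have e := risingFactorial_add c i m
    rw [add_comm, risingFactorial_add] at e
    have h1 := (risingFactorial_pos hc i).ne'
    have h2 := (risingFactorial_pos hc m).ne'
    field_simp
    linear_combination -(u i) * e
  · have ht1 : (n : ℝ) - 2 < t := by
      rcases ht with ⟨m, -, hm⟩ | ht
      · exact absurd ⟨m, hm⟩ hz
      · exact ht
    rcases Nat.eq_zero_or_pos n with rfl | hn
    · intro z _
      simpa [jensen, risingFactorial_zero] using (hu 0 le_rfl).ne'
    refine h.jensen_mul hu (realRooted_jensen_jacobi hc ht1 fun h => hz ⟨n - 1, ?_⟩)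
    rw [h, Nat.cast_sub hn, Nat.cast_one]

/-! ### Hypergeometric polynomials -/

theorem risingFactorial_ne_zero_of_notMem {n : ℕ} {a : ℝ} (ha : -a ∉ zSet n) {j : ℕ}
    (hj : j ≤ n) : risingFactorial (1 - n - a) j ≠ 0 := by
  induction j with
  | zero => simp [risingFactorial_zero]
  | succ j ih =>
    rw [risingFactorial_succ]
    refine mul_ne_zero (ih (by omega)) fun h => ha ⟨n - 1 - j, by omega, ?_⟩
    rw [Nat.sub_sub, Nat.cast_sub (by omega)]
    push_cast
    linarith

theorem risingFactorial_neg_natCast (n j : ℕ) :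
    risingFactorial (-(n : ℝ)) j = (-1) ^ j * (j.factorial * n.choose j) := by
  rw [risingFactorial, ascPochhammer_eval_neg_eq_descPochhammer,
    descPochhammer_eval_eq_descFactorial, Nat.descFactorial_eq_factorial_mul_choose]
  push_cast
  rfl

theorem risingFactorial_reverse (c : ℝ) {n j : ℕ} (hj : j ≤ n) :
    risingFactorial c n = risingFactorial c (n - j) *
      ((-1) ^ j * risingFactorial (1 - n - c) j) := by
  have h1 := risingFactorial_add c (n - j) j
  have h2 := risingFactorial_reflect (c + (n - j : ℕ)) j
  rw [Nat.sub_add_cancel hj] at h1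
  rw [Nat.cast_sub hj, show 1 - (c + ((n : ℝ) - j)) - j = 1 - n - c by ring] at h2
  rw [h1, h2, ← mul_assoc ((-1) ^ j), ← mul_pow, Nat.cast_sub hj]
  simp

/-- The coefficient sequence of a hypergeometric polynomial in the opposite order, without its
positive lower parameter. -/
noncomputable def reversedCoeff (n : ℕ) (a₁ a₂ b₁ : ℝ) (i : ℕ) : ℝ :=
  risingFactorial (1 - n - b₁) i /
    (risingFactorial (1 - n - a₁) i * risingFactorial (1 - n - a₂) i)

theorem reversedCoeff_zero (n : ℕ) (a₁ a₂ b₁ : ℝ) : reversedCoeff n a₁ a₂ b₁ 0 = 1 := by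
  simp [reversedCoeff, risingFactorial_zero]

/-- The binomial comes from `(-n)_j / j! = (-1)^j binom(n, j)`. All parameters except `b₂` are
reflected, while `(b₂ + j)_(n-j) = (b₂)_n / (b₂)_j` keeps `b₂` as a multiplier. -/
theorem map_hypergeometricPoly {n : ℕ} {a₁ a₂ b₁ b₂ : ℝ} (ha₁ : -a₁ ∉ zSet n)
    (ha₂ : -a₂ ∉ zSet n) (hb₂ : 0 < b₂) :
    (hypergeometricPoly n [a₁, a₂] [b₁, b₂]).map Complex.ofRealHom =
      jensen n fun j => ((-1) ^ n * risingFactorial (1 - n - a₁) n *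
        risingFactorial (1 - n - a₂) n * risingFactorial b₂ n) *
          (reversedCoeff n a₁ a₂ b₁ (n - j) / risingFactorial b₂ j) := by
  rw [hypergeometricPoly, jensen, Polynomial.map_sum]
  refine Finset.sum_congr rfl fun j hj => ?_
  have hj : j ≤ n := Nat.lt_succ_iff.1 (Finset.mem_range.1 hj)
  rw [Polynomial.map_mul, Polynomial.map_pow, map_X, map_C, Complex.ofRealHom_eq_coe]
  congr 3
  have e1 := risingFactorial_reverse (1 - n - a₁) hj
  have e2 := risingFactorial_reverse (1 - n - a₂) hj
  rw [show 1 - (n : ℝ) - (1 - n - a₁) = a₁ by ring] at e1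
  rw [show 1 - (n : ℝ) - (1 - n - a₂) = a₂ by ring] at e2
  have e3 := risingFactorial_reflect (1 - n - b₁) (n - j)
  rw [Nat.cast_sub hj, show 1 - (1 - (n : ℝ) - b₁) - (n - j) = b₁ + j by ring] at e3
  have e4 := risingFactorial_add b₂ j (n - j)
  rw [Nat.add_sub_cancel' hj] at e4
  have n1 := risingFactorial_ne_zero_of_notMem ha₁ (Nat.sub_le n j)
  have n2 := risingFactorial_ne_zero_of_notMem ha₂ (Nat.sub_le n j)
  have n3 := (risingFactorial_pos hb₂ j).ne'
  have n4 : (j.factorial : ℝ) ≠ 0 := by exact_mod_cast j.factorial_ne_zero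
  have hs : ((-1 : ℝ)) ^ n = (-1) ^ j * (-1) ^ (n - j) := by
    rw [← pow_add, Nat.add_sub_cancel' hj]
  have hs2 : ((-1 : ℝ) ^ j) ^ 2 = 1 := by rw [← pow_mul, mul_comm, pow_mul]; simp
  simp only [List.map_cons, List.map_nil, List.prod_cons, List.prod_nil, mul_one]
  rw [risingFactorial_neg_natCast, reversedCoeff, e1, e2, e3, e4, hs]
  field_simp
  rw [hs2]
  ring

theorem natDegree_hypergeometricPoly_le (n : ℕ) (a b : List ℝ) :
    (hypergeometricPoly n a b).natDegree ≤ n :=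
  natDegree_sum_le_of_forall_le _ _ fun _ hj =>
    (natDegree_C_mul_X_pow_le _ _).trans (Nat.lt_succ_iff.1 (Finset.mem_range.1 hj))

theorem realRooted_map_hypergeometricPoly {n : ℕ} {a₁ a₂ b₁ b₂ : ℝ} (ha₁ : -a₁ ∉ zSet n)
    (ha₂ : -a₂ ∉ zSet n) (hb₂ : 0 < b₂) (h : RealRooted (jensen n (reversedCoeff n a₁ a₂ b₁))) :
    RealRooted ((hypergeometricPoly n [a₁, a₂] [b₁, b₂]).map Complex.ofRealHom) := by
  rw [map_hypergeometricPoly ha₁ ha₂ hb₂]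
  refine (h.jensen_reverse.jensen_div_risingFactorial ?_ hb₂).jensen_const_mul ?_
  · rw [Nat.sub_self, reversedCoeff_zero]
    exact one_ne_zero
  · have h1 := risingFactorial_ne_zero_of_notMem ha₁ le_rfl
    have h2 := risingFactorial_ne_zero_of_notMem ha₂ le_rfl
    have h3 := (risingFactorial_pos hb₂ n).ne'
    simp [h1, h2, h3]

theorem eval_map_hypergeometricPoly (n : ℕ) (a b : List ℝ) (z : ℂ) :
    ((hypergeometricPoly n a b).map Complex.ofRealHom).eval z =
      aeval z (hypergeometricPoly n a b) := by
  rw [eval_map, aeval_def]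
  rfl

theorem hypergeometricPoly_mem_realLine {n : ℕ} {a₁ a₂ b₁ b₂ : ℝ} (ha₁ : -a₁ ∉ zSet n)
    (ha₂ : -a₂ ∉ zSet n) (hb₂ : 0 < b₂) (h : RealRooted (jensen n (reversedCoeff n a₁ a₂ b₁))) :
    hypergeometricPoly n [a₁, a₂] [b₁, b₂] ∈ polysWithZerosIn n realLine := by
  refine ⟨natDegree_hypergeometricPoly_le n _ _, fun z hz => ⟨z.re, ?_⟩⟩
  have hr := realRooted_map_hypergeometricPoly ha₁ ha₂ hb₂ h z
  rw [eval_map_hypergeometricPoly] at hr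
  refine Complex.ext rfl ?_
  by_contra him
  exact hr (fun h => him (by simpa using h.symm)) hz

theorem hypergeometricPoly_mem_negativeLine {n : ℕ} {a₁ a₂ b₁ b₂ : ℝ} (ha₁ : -a₁ ∉ zSet n)
    (ha₂ : -a₂ ∉ zSet n) (hb₂ : 0 < b₂) (h : RealRooted (jensen n (reversedCoeff n a₁ a₂ b₁)))
    (hpos : ∀ i, 0 < reversedCoeff n a₁ a₂ b₁ i) :
    hypergeometricPoly n [a₁, a₂] [b₁, b₂] ∈ polysWithZerosIn n negativeLine := by
  obtain ⟨hdeg, hroot⟩ := hypergeometricPoly_mem_realLine ha₁ ha₂ hb₂ h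
  refine ⟨hdeg, fun z hz => ?_⟩
  obtain ⟨x, rfl⟩ := hroot z hz
  refine ⟨x, ?_, rfl⟩
  set V : ℕ → ℝ := fun j => reversedCoeff n a₁ a₂ b₁ (n - j) / risingFactorial b₂ j with hV
  have hVpos : ∀ j ≤ n, 0 < V j := fun j _ => div_pos (hpos _) (risingFactorial_pos hb₂ j)
  have hVr : RealRooted (jensen n V) := by
    refine h.jensen_reverse.jensen_div_risingFactorial ?_ hb₂
    rw [Nat.sub_self, reversedCoeff_zero]
    exact one_ne_zero
  have h1 := risingFactorial_ne_zero_of_notMem ha₁ le_rfl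
  have h2 := risingFactorial_ne_zero_of_notMem ha₂ le_rfl
  have h3 := (risingFactorial_pos hb₂ n).ne'
  rw [← eval_map_hypergeometricPoly, map_hypergeometricPoly ha₁ ha₂ hb₂, jensen_const_mul,
    eval_mul, eval_C] at hz
  have hz := (mul_eq_zero.1 hz).resolve_left (by simp [h1, h2, h3])
  simpa using re_neg_of_mem_roots_jensen hVr hVpos ((mem_roots hVr.ne_zero).2 hz)

/-! ### Quotients of rising factorials -/

/-- Here `(2e + i)_i = (2e)_(2i) / (2e)_i`, and duplication gives `(2e)_(2i) = 4^i (e)_i (e +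
1/2)_i`. Scaling the variable by `1/4` removes the power of four. -/
theorem realRooted_jensen_duplication {p q e : ℝ} (hp : -1 < p) (hp0 : p ≠ 0) (hq : -1 < q)
    (hq0 : q ≠ 0) (hpq : p + q - 1 = 2 * e) {n : ℕ}
    (he : ∀ i ≤ n, risingFactorial (2 * e) i ≠ 0) :
    RealRooted (jensen n fun i => risingFactorial e i * risingFactorial (e + 1 / 2) i /
      (risingFactorial (2 * e) i * (risingFactorial p i * risingFactorial q i))) := by
  have := (realRooted_jensen_bessel_mul hp hp0 hq hq0 n).jensen_scale
    (inv_ne_zero (four_ne_zero (α := ℝ)))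
  rwa [jensen_congr fun i hi => ?_] at this
  have h1 := risingFactorial_add (2 * e) i i
  rw [← two_mul, risingFactorial_two_mul, ← hpq] at h1
  have h2 := he i hi
  have h3 := risingFactorial_ne_zero hp hp0 i
  have h4 := risingFactorial_ne_zero hq hq0 i
  rw [← hpq] at h2 ⊢
  rw [inv_pow]
  generalize risingFactorial (e + 1 / 2) i = r at h1 ⊢
  field_simp
  linear_combination -h1

/-- The choice `p = q = e + 1/2` cancels one factor `(e + 1/2)_i`. -/
theorem realRooted_jensen_bessel_sq {e : ℝ} (he : -1 < e + 1 / 2) (he0 : e + 1 / 2 ≠ 0) {n : ℕ}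
    (h : ∀ i ≤ n, risingFactorial (2 * e) i ≠ 0) :
    RealRooted (jensen n fun i => risingFactorial e i /
      (risingFactorial (2 * e) i * risingFactorial (e + 1 / 2) i)) := by
  have := realRooted_jensen_duplication he he0 he he0 (by ring) h
  rwa [jensen_congr fun i hi => ?_] at this
  have h1 := h i hi
  have h2 := risingFactorial_ne_zero he he0 i
  field_simp

/-- The choice `p = e`, `q = e + 1` cancels `(e)_i`. -/
theorem realRooted_jensen_bessel_contiguous {e : ℝ} (he : -1 < e) (he0 : e ≠ 0) {n : ℕ}
    (h : ∀ i ≤ n, risingFactorial (2 * e) i ≠ 0) :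
    RealRooted (jensen n fun i => risingFactorial (e + 1 / 2) i /
      (risingFactorial (2 * e) i * risingFactorial (e + 1) i)) := by
  have := realRooted_jensen_duplication (q := e + 1) he he0 (by linarith) (by linarith)
    (by ring) h
  rwa [jensen_congr fun i hi => ?_] at this
  have h1 := h i hi
  have h2 := risingFactorial_ne_zero he he0 i
  have h3 := (risingFactorial_pos (show 0 < e + 1 by linarith) i).ne'
  field_simp

/-- The choice `p + q = 2`, that is `e = 1/2`, cancels `(1)_i`. -/
theorem realRooted_jensen_bessel_two_sub {c : ℝ} (hc : -1 < c) (hc0 : c ≠ 0) (hc2 : c < 2)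
    (n : ℕ) :
    RealRooted (jensen n fun i => risingFactorial (1 / 2) i /
      (risingFactorial (2 - c) i * risingFactorial c i)) := by
  have := realRooted_jensen_duplication (q := 2 - c) (e := 1 / 2) (n := n) hc hc0 (by linarith)
    (by linarith) (by ring) fun i _ => (risingFactorial_pos (by norm_num) i).ne'
  rwa [jensen_congr fun i hi => ?_] at this
  have h1 := risingFactorial_ne_zero hc hc0 i
  have h3 := (risingFactorial_pos (show 0 < 2 - c by linarith) i).ne'
  have h4 := (risingFactorial_pos one_pos i).ne'
  rw [show (1 : ℝ) / 2 + 1 / 2 = 1 by norm_num, show (2 : ℝ) * (1 / 2) = 1 by norm_num]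
  field_simp

/-- Obtained from the parameter `2 - c` by the linear multiplier `(1 - c + i) / (1 - c)`. -/
theorem realRooted_jensen_bessel_one_sub {c : ℝ} (hc : -1 < c) (hc0 : c ≠ 0) (hc1 : c < 1)
    (n : ℕ) :
    RealRooted (jensen n fun i => risingFactorial (1 / 2) i /
      (risingFactorial (1 - c) i * risingFactorial c i)) := by
  have h1c : 0 < 1 - c := by linarith
  have := ((realRooted_jensen_bessel_two_sub hc hc0 (by linarith) n).jensen_add_index_mul
    h1c).jensen_const_mul (inv_ne_zero h1c.ne')
  rwa [jensen_congr fun i hi => ?_] at this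
  have h1 := risingFactorial_ne_zero hc hc0 i
  have h2 := (risingFactorial_pos h1c i).ne'
  have h3 := (risingFactorial_pos (show 0 < 2 - c by linarith) i).ne'
  have e := risingFactorial_add (1 - c) 1 i
  rw [add_comm, risingFactorial_succ, risingFactorial_one, Nat.cast_one,
    show 1 - c + 1 = 2 - c by ring] at e
  field_simp
  linear_combination risingFactorial (1 / 2) i * e

/-- The ratio `(N + k)_i / (N)_i = (N + i)_k / (N)_k` is a product of linear multipliers; positivity
of `N` is what makes them admissible. -/
theorem RealRooted.jensen_add_nat {N : ℝ} (hN : 0 < N) {n : ℕ} {d : ℕ → ℝ}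
    (h : RealRooted (jensen n fun i => risingFactorial N i / d i)) (k : ℕ) :
    RealRooted (jensen n fun i => risingFactorial (N + k) i / d i) := by
  have := (h.jensen_risingFactorial_mul hN k).jensen_const_mul
    (inv_ne_zero (risingFactorial_pos hN k).ne')
  rwa [jensen_congr fun i hi => ?_] at this
  have e := risingFactorial_add N i k
  rw [add_comm, risingFactorial_add] at e
  have h1 := (risingFactorial_pos hN k).ne'
  rw [mul_div_assoc', mul_comm (risingFactorial (N + i) k), ← e]
  field_simp

/-- The only possibly negative factors, `e` and `2 * e`, have quotient `1/2`. This supplies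
positivity when `e` is negative. -/
theorem risingFactorial_div_two_mul_pos {e : ℝ} (he : -1 / 2 < e) (he0 : e ≠ 0) (i : ℕ) :
    0 < risingFactorial e i / risingFactorial (2 * e) i := by
  rcases i with _ | i
  · simp [risingFactorial_zero]
  · rw [add_comm, risingFactorial_add, risingFactorial_add, risingFactorial_one,
      risingFactorial_one, mul_comm 2 e, mul_assoc, mul_div_mul_left _ _ he0]
    push_cast
    have h1 := risingFactorial_pos (show 0 < e + 1 by linarith) i
    have h2 := risingFactorial_pos (show 0 < e * 2 + 1 by linarith) i
    positivity

/-- The Jacobi multiplier `(d + t)_i / (d)_i` does the exchange; `hpos` provides the positive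
coefficients that it needs. -/
theorem RealRooted.jensen_replace {n : ℕ} {M c d t : ℝ} (hd : 0 < d)
    (ht : t ∈ zSet n ∨ (n : ℝ) - 2 < t) (hdt : 0 < d + t)
    (h : RealRooted (jensen n fun i =>
      risingFactorial M i / (risingFactorial c i * risingFactorial (d + t) i)))
    (hpos : ∀ i, 0 < risingFactorial M i / risingFactorial c i) :
    RealRooted (jensen n fun i =>
      risingFactorial M i / (risingFactorial c i * risingFactorial d i)) := by
  have := h.jensen_mul_jacobi (fun j _ => ?_) hd ht
  · rwa [jensen_congr fun i hi => ?_] at this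
    have h1 := (risingFactorial_pos hd i).ne'
    have h2 := (risingFactorial_pos hdt i).ne'
    field_simp
  · rw [← div_div]
    exact div_pos (hpos j) (risingFactorial_pos hdt j)

theorem hypergeometricPoly_mem_negativeLine_of_params {n : ℕ} {a₁ a₂ b₁ b₂ N c d : ℝ}
    (ha₁ : -a₁ ∉ zSet n) (ha₂ : -a₂ ∉ zSet n) (hb₂ : 0 < b₂) (hN : 1 - n - b₁ = N)
    (hc : 1 - n - a₁ = c) (hd : 1 - n - a₂ = d) (hd0 : 0 < d)
    (h : RealRooted (jensen n fun i =>
      risingFactorial N i / (risingFactorial c i * risingFactorial d i)))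
    (hpos : ∀ i, 0 < risingFactorial N i / risingFactorial c i) :
    hypergeometricPoly n [a₁, a₂] [b₁, b₂] ∈ polysWithZerosIn n negativeLine := by
  subst hN hc hd
  refine hypergeometricPoly_mem_negativeLine ha₁ ha₂ hb₂ h fun i => ?_
  rw [reversedCoeff, ← div_div]
  exact div_pos (hpos i) (risingFactorial_pos hd0 i)

theorem hypergeometricPoly_mem_realLine_of_params {n : ℕ} {a₁ a₂ b₁ b₂ N c d : ℝ}
    (ha₁ : -a₁ ∉ zSet n) (ha₂ : -a₂ ∉ zSet n) (hb₂ : 0 < b₂) (hN : 1 - n - b₁ = N)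
    (hc : 1 - n - a₁ = c) (hd : 1 - n - a₂ = d)
    (h : RealRooted (jensen n fun i =>
      risingFactorial N i / (risingFactorial c i * risingFactorial d i))) :
    hypergeometricPoly n [a₁, a₂] [b₁, b₂] ∈ polysWithZerosIn n realLine := by
  subst hN hc hd
  exact hypergeometricPoly_mem_realLine ha₁ ha₂ hb₂ h

/-! ### Matching each parameter family to a Bessel product -/

theorem mainTheorem12 (n k : ℕ) (t a₁ a₂ b₁ b₂ : ℝ) (hn : 4 ≤ n)
    (hk : k < n) (ht : t ∈ zSet n ∨ (n : ℝ) - 2 < t)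
    (ha₁ : -a₁ ∉ zSet n) (ha₂ : -a₂ ∉ zSet n) (hb₂ : 0 < b₂) :
    (a₂ < -(n : ℝ) + 1 →
      -- (i)
      ((b₁ = -(n : ℝ) - k + 1 / 2 ∧
          ((a₁ = -a₂ - 2 * n ∧ -a₂ - 2 * n < -(n : ℝ) + 1) ∨
            (a₁ = -a₂ - 2 * n + 1 ∧ -a₂ - 2 * n + 1 < -(n : ℝ) + 1))) ∨
      -- (ii)
        (b₁ = a₁ - k + 1 / 2 ∧ a₁ = (a₂ - n - t) / 2) ∨
      -- (iii)
        (b₁ = (a₁ - n) / 2 - k ∧ a₁ = 2 * a₂ + n + 1 - 2 * t ∧ a₁ < -(n : ℝ) + 1) ∨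
      -- (iv)
        (b₁ = (a₁ - n + 1) / 2 - k ∧ a₁ = 2 * a₂ + n - 2 * t ∧
          (a₁ < -(n : ℝ) + 1 ∨ k = 0))) →
      hypergeometricPoly n [a₁, a₂] [b₁, b₂] ∈ polysWithZerosIn n negativeLine) ∧
    -- (v)
    (((b₁ = a₂ + 1 / 2 ∧ a₁ = 2 * a₂ + n + 1 ∧
          a₂ ∈ Set.Ioo (-(n : ℝ)) (-(n : ℝ) + 1)) ∨
      -- (vi)
        (b₁ = a₂ + 1 / 2 ∧ a₁ = 2 * a₂ + n ∧
          a₂ ∈ Set.Ioo (-(n : ℝ) + 1) (-(n : ℝ) + 2)) ∨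
      -- (vii)
        (b₁ = a₂ - k + 1 / 2 ∧ a₁ = 2 * a₂ + n + 1 ∧
          a₂ ∈ Set.Ioo (-(n : ℝ)) (-(n : ℝ) + 1 / 2)) ∨
      -- (viii)
        (b₁ = -(n : ℝ) - k + 1 / 2 ∧ (a₁ + a₂ + 2 * n = 0 ∨ a₁ + a₂ + 2 * n = 1) ∧
          a₂ ∈ Set.Ioo (-(n : ℝ) + 1) (-(n : ℝ) + 2))) →
      hypergeometricPoly n [a₁, a₂] [b₁, b₂] ∈ polysWithZerosIn n realLine) := by
  have hc₁ := fun i (hi : i ≤ n) => risingFactorial_ne_zero_of_notMem ha₁ hi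
  have ht0 : 0 ≤ t := by
    have : (4 : ℝ) ≤ n := by exact_mod_cast hn
    rcases ht with ⟨m, -, rfl⟩ | ht
    · exact m.cast_nonneg
    · linarith
  have hk0 : (0 : ℝ) ≤ k := k.cast_nonneg
  refine ⟨fun ha h => ?_, fun h => ?_⟩
  · have hd : 0 < 1 - n - a₂ := by linarith
    rcases h with ⟨hb, h | h⟩ | ⟨hb, h⟩ | ⟨hb, h, h1⟩ | ⟨hb, h, h1⟩
    · have hr := (realRooted_jensen_bessel_two_sub (c := 1 - n - a₂) (by linarith) hd.ne'
        (by linarith) n).jensen_add_nat (by norm_num) k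
      refine hypergeometricPoly_mem_negativeLine_of_params ha₁ ha₂ hb₂ (by rw [hb]; ring)
        (by rw [h.1]; ring) rfl hd hr fun i => ?_
      exact div_pos (risingFactorial_pos (by linarith) i) (risingFactorial_pos (by linarith) i)
    · have hr := (realRooted_jensen_bessel_one_sub (c := 1 - n - a₂) (by linarith) hd.ne'
        (by linarith) n).jensen_add_nat (by norm_num) k
      refine hypergeometricPoly_mem_negativeLine_of_params ha₁ ha₂ hb₂ (by rw [hb]; ring)
        (by rw [h.1]; ring) rfl hd hr fun i => ?_
      exact div_pos (risingFactorial_pos (by linarith) i) (risingFactorial_pos (by linarith) i)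
    -- Here `e` is chosen so that `2 * e = d + t` and `c = e + 1/2`, where `c = 1 - n - a₁` and `d =
    -- 1 - n - a₂`. The squared Bessel case then applies before `d + t` is replaced by `d`.
    · set e := (1 - n - a₂ + t) / 2 with he
      have he0 : 0 < e := by linarith
      have h2e : 2 * e = 1 - n - a₂ + t := by rw [he]; ring
      have hr := (realRooted_jensen_bessel_sq (e := e) (by linarith) (by linarith) (n := n)
        fun i _ => (risingFactorial_pos (by linarith) i).ne').jensen_add_nat he0 k
      have hpos : ∀ i, 0 < risingFactorial (e + k) i / risingFactorial (e + 1 / 2) i :=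
        fun i => div_pos (risingFactorial_pos (by linarith) i) (risingFactorial_pos (by linarith) i)
      rw [h2e, jensen_congr fun i _ => by rw [mul_comm]] at hr
      exact hypergeometricPoly_mem_negativeLine_of_params ha₁ ha₂ hb₂
        (by rw [hb, h, he]; ring) (by rw [h, he]; ring) rfl hd
        (hr.jensen_replace hd ht (by linarith) hpos) hpos
    -- Now `c = 2 * e` and `d + t = e + 1`, the contiguous case.
    · set e := (1 - n - a₁) / 2 with he
      have he0 : 0 < e := by linarith
      have h2e : 2 * e = 1 - n - a₁ := by rw [he]; ring
      have hr := (realRooted_jensen_bessel_contiguous (e := e) (by linarith) he0.ne' (n := n)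
        (by rwa [h2e])).jensen_add_nat (by linarith) k
      have hpos : ∀ i, 0 < risingFactorial (e + 1 / 2 + k) i / risingFactorial (2 * e) i :=
        fun i => div_pos (risingFactorial_pos (by linarith) i) (risingFactorial_pos (by linarith) i)
      rw [show e + 1 = 1 - n - a₂ + t by rw [he, h]; ring] at hr
      exact hypergeometricPoly_mem_negativeLine_of_params ha₁ ha₂ hb₂
        (by rw [hb, he]; ring) h2e.symm rfl hd
        (hr.jensen_replace hd ht (by linarith) hpos) hpos
    -- Now `c = 2 * e` and `d + t = e + 1/2`. Positivity of `d + t` only gives `e > -1/2`, so `e`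
    -- may be negative; raising `e` by `k` needs `e > 0`, hence the alternative `k = 0`.
    · set e := (1 - n - a₁) / 2 with he
      have hde : e + 1 / 2 = 1 - n - a₂ + t := by rw [he, h]; ring
      have h2e : 2 * e = 1 - n - a₁ := by rw [he]; ring
      -- The value `e = 0` would mean `-a₁ = n - 1`, which is excluded.
      have he0 : e ≠ 0 := by
        intro h0
        have := hc₁ 1 (by omega)
        rw [risingFactorial_one, ← h2e, h0, mul_zero] at this
        exact this rfl
      have hr := realRooted_jensen_bessel_sq (e := e) (by linarith) (by linarith) (n := n)
        (by rwa [h2e])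
      have hrk : RealRooted (jensen n fun i => risingFactorial (e + k) i /
          (risingFactorial (2 * e) i * risingFactorial (e + 1 / 2) i)) := by
        rcases h1 with h1 | rfl
        · exact hr.jensen_add_nat (by linarith) k
        · simpa using hr
      have hpos : ∀ i, 0 < risingFactorial (e + k) i / risingFactorial (2 * e) i := by
        intro i
        rcases h1 with h1 | rfl
        · exact div_pos (risingFactorial_pos (by linarith) i) (risingFactorial_pos (by linarith) i)
        · simpa using risingFactorial_div_two_mul_pos (e := e) (by linarith) he0 i
      rw [hde] at hrk
      exact hypergeometricPoly_mem_negativeLine_of_params ha₁ ha₂ hb₂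
        (by rw [hb, he]; ring) h2e.symm rfl hd
        (hrk.jensen_replace hd ht (by linarith) hpos) hpos
  · rcases h with ⟨hb, h, hl, hu⟩ | ⟨hb, h, hl, hu⟩ | ⟨hb, h, hl, hu⟩ | ⟨hb, h | h, hl, hu⟩
    -- In this contiguous case `e = -n - a₂` lies in `(-1, 0)`, so one Bessel parameter is negative
    -- and positivity of the coefficients is not available.
    · have h2e : 2 * (-n - a₂) = 1 - n - a₁ := by rw [h]; ring
      have hr := realRooted_jensen_bessel_contiguous (e := -n - a₂) (by linarith) (by linarith)
        (n := n) (by rwa [h2e])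
      exact hypergeometricPoly_mem_realLine_of_params ha₁ ha₂ hb₂ (by rw [hb]; ring)
        h2e.symm (by ring) hr
    · have h2e : 2 * (1 / 2 - n - a₂) = 1 - n - a₁ := by rw [h]; ring
      have hr := realRooted_jensen_bessel_sq (e := 1 / 2 - n - a₂) (by linarith) (by linarith)
        (n := n) (by rwa [h2e])
      exact hypergeometricPoly_mem_realLine_of_params ha₁ ha₂ hb₂ (by rw [hb]; ring)
        h2e.symm (by ring) hr
    -- The narrower interval gives `e + 1/2 > 0`, which is what raising that parameter by `k`
    -- requires.
    · have h2e : 2 * (-n - a₂) = 1 - n - a₁ := by rw [h]; ring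
      have hr := (realRooted_jensen_bessel_contiguous (e := -n - a₂) (by linarith) (by linarith)
        (n := n) (by rwa [h2e])).jensen_add_nat (by linarith) k
      exact hypergeometricPoly_mem_realLine_of_params ha₁ ha₂ hb₂ (by rw [hb]; ring)
        h2e.symm (by ring) hr
    · have hr := (realRooted_jensen_bessel_two_sub (c := 1 - n - a₂) (by linarith) (by linarith)
        (by linarith) n).jensen_add_nat (by norm_num) k
      exact hypergeometricPoly_mem_realLine_of_params ha₁ ha₂ hb₂ (by rw [hb]; ring)
        (by linarith) rfl hr
    · have hr := (realRooted_jensen_bessel_one_sub (c := 1 - n - a₂) (by linarith) (by linarith)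
        (by linarith) n).jensen_add_nat (by norm_num) k
      exact hypergeometricPoly_mem_realLine_of_params ha₁ ha₂ hb₂ (by rw [hb]; ring)
        (by linarith) rfl hr
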